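/- Let $n,d\in\mathbb{N}$ and identify matrices on $(\mathbb{C}^d)^{\otimes n}$ with complex $d^n\times d^n$ matrices in the product basis. For such a matrix $M$ and $i\in\{1,\dots,n\}$, let $M_i$ be the $i$-th partial trace, i.e. the $d\times d$ matrix obtained from $M$ by tracing out all tensor factors except the $i$-th one. For $p\in[1,\infty]$ let $\|\cdot\|_p$ denote the Schatten $p$-norm, i.e. the $\ell^p$-norm of the vector of singular values (with multiplicities), and put $1/\infty:=0$. Then for every $p\in[1,\infty]$ and every complex matrix $M$ on $(\mathbb{C}^d)^{\otimes n}$ (of arbitrary rank), $$\sum_{i=1}^n\|M_i\|_p\;\le\; n\cdot d^{(n-1)(1-1/p)}\,\|M\|_p .$$ Moreover, equality holds for $M=\mathbb{1}_d^{\otimes n}$, the $n$-fold tensor power of the $d\times d$ identity matrix, for every $p\in[1,\infty]$. -/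

import Mathlib

open scoped ENNReal

/-- The Kronecker product `A 0 ⊗ A 1 ⊗ ⋯ ⊗ A (n - 1)` of `d × d` matrices, as a matrix on
`(ℂ^d)^{⊗n}`. The standard basis vectors of `(ℂ^d)^{⊗n}` are indexed by the multi-indices
`x : Fin n → Fin d`. -/
def tensorMatrix {n d : ℕ} (A : Fin n → Matrix (Fin d) (Fin d) ℂ) :
    Matrix (Fin n → Fin d) (Fin n → Fin d) ℂ :=
  Matrix.of fun x y => ∏ i, A i (x i) (y i)

/-- The `i`-th partial trace `M_i` of a matrix `M` on `(ℂ^d)^{⊗n}`: all the tensor factors except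
the `i`-th one are traced out. Its entry `(a, b)` is the sum of all the entries `M x y` where
`x i = a`, `y i = b` and `x j = y j` for every `j ≠ i`. -/
def partialTrace {n d : ℕ} (i : Fin n) (M : Matrix (Fin n → Fin d) (Fin n → Fin d) ℂ) :
    Matrix (Fin d) (Fin d) ℂ :=
  Matrix.of fun a b => ∑ x : Fin n → Fin d with x i = a, M x (Function.update x i b)

/-- The Schatten `p`-norm of a complex square matrix: the `ℓ^p`-norm of the vector of its singular
values, listed with multiplicity (for `p = ∞`, the largest singular value). -/
noncomputable def schattenNorm (p : ℝ≥0∞) {m : Type*} [Fintype m] [DecidableEq m]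
    (A : Matrix m m ℂ) : ℝ :=
  ‖WithLp.toLp p fun k : Fin (Fintype.card m) =>
    (Matrix.toEuclideanLin A).singularValues (k : ℕ)‖

/-! Each summand is bounded on its own. With singular vectors `u k`, `v k` of `M_i`, the `k`-th
singular value is `⟨u k, M_i (v k)⟩ = ∑ e, ⟨u k ⊗ e, M (v k ⊗ e)⟩`, a sum over `d ^ (n - 1)` basis
vectors `e` (`inner_partialTrace`). For finite `p`, the power mean inequality bounds its `p`-th
power at the cost of `d ^ ((n - 1) * (p - 1))`. The vectors `u k ⊗ e` are orthonormal, as are the `v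
k ⊗ e`, so `sum_rpow_norm_inner_le_schattenNorm_rpow` bounds the remaining double sum by `‖M‖_p ^
p`. For `p = ∞` each term is at most `‖M‖_∞`. -/

/-! ### Singular vectors and substochastic weights -/

/-- Singular value decomposition of an endomorphism of a finite-dimensional inner product space. -/
theorem LinearMap.exists_orthonormalBasis_singularValues {𝕜 E : Type*} [RCLike 𝕜]
    [NormedAddCommGroup E] [InnerProductSpace 𝕜 E] [FiniteDimensional 𝕜 E] (T : E →ₗ[𝕜] E)
    {N : ℕ} (hN : Module.finrank 𝕜 E = N) :
    ∃ u v : OrthonormalBasis (Fin N) 𝕜 E, ∀ k : Fin N,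
      T (v k) = (T.singularValues (k : ℕ) : 𝕜) • u k := by
  set v := T.isSymmetric_adjoint_comp_self.eigenvectorBasis hN with hv
  have hinner : ∀ k l, inner 𝕜 (T (v k)) (T (v l)) =
      (T.singularValues (l : ℕ) : 𝕜) ^ 2 * if k = l then 1 else 0 := by
    intro k l
    rw [← LinearMap.adjoint_inner_right, ← LinearMap.comp_apply, hv,
      T.isSymmetric_adjoint_comp_self.apply_eigenvectorBasis hN l, inner_smul_right, ← hv,
      orthonormal_iff_ite.mp v.orthonormal, ← T.sq_singularValues_fin hN l]
    push_cast
    rfl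
  -- Only nonzero singular values prescribe `u k`; elsewhere `T (v k) = 0`, so any orthonormal
  -- completion works.
  set s : Set (Fin N) := {k | T.singularValues (k : ℕ) ≠ 0}
  have hs : Orthonormal 𝕜
      (s.domRestrict fun k => (T.singularValues (k : ℕ) : 𝕜)⁻¹ • T (v k)) := by
    rw [orthonormal_iff_ite]
    rintro ⟨k, hk⟩ ⟨l, hl⟩
    have hl' : (T.singularValues (l : ℕ) : 𝕜) ≠ 0 := by exact_mod_cast hl
    simp only [Set.domRestrict_apply, inner_smul_left, inner_smul_right, hinner, Subtype.mk.injEq]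
    by_cases hkl : k = l
    · subst hkl
      simp only [map_inv₀, RCLike.conj_ofReal, if_true]
      field_simp
    · simp [hkl]
  obtain ⟨u, hu⟩ := hs.exists_orthonormalBasis_extension_of_card_eq (by simpa using hN)
  refine ⟨u, v, fun k => ?_⟩
  by_cases hk : T.singularValues (k : ℕ) = 0
  · have h0 : inner 𝕜 (T (v k)) (T (v k)) = 0 := by
      rw [hinner, hk]
      simp
    rw [inner_self_eq_zero.mp h0, hk]
    simp
  · have hk' : (T.singularValues (k : ℕ) : 𝕜) ≠ 0 := by exact_mod_cast hk
    rw [hu k hk, smul_inv_smul₀ hk']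

/-- AM-GM followed by Bessel's inequality for each family. -/
theorem Orthonormal.sum_norm_inner_mul_norm_inner_le {𝕜 E ι : Type*} [RCLike 𝕜]
    [NormedAddCommGroup E] [InnerProductSpace 𝕜 E] [Fintype ι] {u v : ι → E}
    (hu : Orthonormal 𝕜 u) (hv : Orthonormal 𝕜 v) {x y : E} (hx : ‖x‖ = 1) (hy : ‖y‖ = 1) :
    ∑ k, ‖inner 𝕜 (u k) x‖ * ‖inner 𝕜 (v k) y‖ ≤ 1 := by
  have h1 := hu.sum_inner_products_le x (s := Finset.univ)
  have h2 := hv.sum_inner_products_le y (s := Finset.univ)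
  rw [hx] at h1
  rw [hy] at h2
  have h3 : ∑ k, ‖inner 𝕜 (u k) x‖ * ‖inner 𝕜 (v k) y‖ ≤
      ∑ k, (‖inner 𝕜 (u k) x‖ ^ 2 + ‖inner 𝕜 (v k) y‖ ^ 2) / 2 :=
    Finset.sum_le_sum fun k _ => by
      linarith [two_mul_le_add_sq ‖inner 𝕜 (u k) x‖ ‖inner 𝕜 (v k) y‖]
  rw [← Finset.sum_div, Finset.sum_add_distrib] at h3
  linarith

theorem LinearMap.norm_inner_le_sum_singularValues {𝕜 E : Type*} [RCLike 𝕜]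
    [NormedAddCommGroup E] [InnerProductSpace 𝕜 E] {N : ℕ} {T : E →ₗ[𝕜] E}
    {σ : Fin N → ℝ} (hσ : ∀ k, 0 ≤ σ k) {u v : OrthonormalBasis (Fin N) 𝕜 E}
    (h : ∀ k, T (v k) = (σ k : 𝕜) • u k) (x y : E) :
    ‖inner 𝕜 x (T y)‖ ≤ ∑ k, (‖inner 𝕜 (u k) x‖ * ‖inner 𝕜 (v k) y‖) * σ k := by
  have hy : T y = ∑ k, (inner 𝕜 (v k) y * (σ k : 𝕜)) • u k := by
    conv_lhs => rw [← v.sum_repr' y]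
    simp [map_sum, h, smul_smul]
  rw [hy, inner_sum]
  refine (norm_sum_le _ _).trans (Finset.sum_le_sum fun k _ => le_of_eq ?_)
  rw [inner_smul_right, norm_mul, norm_mul, RCLike.norm_ofReal, abs_of_nonneg (hσ k),
    norm_inner_symm x]
  ring

/-- Jensen's inequality survives total mass below one: Hölder's extra factor `(∑ i, w i) ^ (1 -
p⁻¹)` is at most one. -/
theorem Real.rpow_sum_mul_le_sum_mul_rpow {ι : Type*} [Fintype ι] {w z : ι → ℝ}
    (hw : ∀ i, 0 ≤ w i) (hw1 : ∑ i, w i ≤ 1) (hz : ∀ i, 0 ≤ z i) {p : ℝ} (hp : 1 ≤ p) :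
    (∑ i, w i * z i) ^ p ≤ ∑ i, w i * z i ^ p := by
  have hp0 : 0 < p := by linarith
  have hS : 0 ≤ ∑ i, w i * z i ^ p :=
    Finset.sum_nonneg fun i _ => mul_nonneg (hw i) (Real.rpow_nonneg (hz i) _)
  have h := Real.inner_le_weight_mul_Lp_of_nonneg Finset.univ hp w z hw hz
  have h1 : (∑ i, w i) ^ (1 - p⁻¹) ≤ 1 :=
    Real.rpow_le_one (Finset.sum_nonneg fun i _ => hw i) hw1
      (sub_nonneg.mpr (inv_le_one_of_one_le₀ hp))
  have h2 : ∑ i, w i * z i ≤ (∑ i, w i * z i ^ p) ^ p⁻¹ :=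
    h.trans (mul_le_of_le_one_left (Real.rpow_nonneg hS _) h1)
  calc (∑ i, w i * z i) ^ p ≤ ((∑ i, w i * z i ^ p) ^ p⁻¹) ^ p :=
        Real.rpow_le_rpow (Finset.sum_nonneg fun i _ => mul_nonneg (hw i) (hz i)) h2 hp0.le
    _ = _ := Real.rpow_inv_rpow hS hp0.ne'

/-! ### Schatten norms tested on orthonormal families -/

theorem Matrix.exists_singularValueDecomposition {m : Type*} [Fintype m] [DecidableEq m]
    (A : Matrix m m ℂ) :
    ∃ u v : OrthonormalBasis (Fin (Fintype.card m)) ℂ (EuclideanSpace ℂ m), ∀ k,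
      Matrix.toEuclideanLin A (v k) =
        ((Matrix.toEuclideanLin A).singularValues (k : ℕ) : ℂ) • u k :=
  LinearMap.exists_orthonormalBasis_singularValues _ finrank_euclideanSpace

theorem schattenNorm_nonneg {m : Type*} [Fintype m] [DecidableEq m] {p : ℝ≥0∞} (hp : 1 ≤ p)
    (A : Matrix m m ℂ) : 0 ≤ schattenNorm p A :=
  have : Fact (1 ≤ p) := ⟨hp⟩
  norm_nonneg _

theorem schattenNorm_eq_sum {m : Type*} [Fintype m] [DecidableEq m] {p : ℝ≥0∞}
    (hp : 0 < p.toReal) (A : Matrix m m ℂ) :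
    schattenNorm p A = (∑ k : Fin (Fintype.card m),
      (Matrix.toEuclideanLin A).singularValues (k : ℕ) ^ p.toReal) ^ (1 / p.toReal) := by
  rw [schattenNorm, PiLp.norm_eq_sum hp]
  simp only [Real.norm_of_nonneg (LinearMap.singularValues_nonneg _ _)]

theorem schattenNorm_rpow {m : Type*} [Fintype m] [DecidableEq m] {p : ℝ≥0∞}
    (hp : 0 < p.toReal) (A : Matrix m m ℂ) :
    schattenNorm p A ^ p.toReal = ∑ k : Fin (Fintype.card m),
      (Matrix.toEuclideanLin A).singularValues (k : ℕ) ^ p.toReal := by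
  rw [schattenNorm_eq_sum hp, one_div, Real.rpow_inv_rpow _ hp.ne']
  exact Finset.sum_nonneg fun k _ => Real.rpow_nonneg (LinearMap.singularValues_nonneg _ _) _

theorem singularValues_le_schattenNorm_top {m : Type*} [Fintype m] [DecidableEq m]
    (A : Matrix m m ℂ) (k : Fin (Fintype.card m)) :
    (Matrix.toEuclideanLin A).singularValues (k : ℕ) ≤ schattenNorm ∞ A := by
  refine (le_abs_self _).trans ?_
  exact PiLp.norm_apply_le (p := ∞) (WithLp.toLp ∞ fun k : Fin (Fintype.card m) =>
    (Matrix.toEuclideanLin A).singularValues (k : ℕ)) k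

theorem schattenNorm_top_le {m : Type*} [Fintype m] [DecidableEq m] {A : Matrix m m ℂ} {C : ℝ}
    (hC : 0 ≤ C)
    (h : ∀ k : Fin (Fintype.card m), (Matrix.toEuclideanLin A).singularValues (k : ℕ) ≤ C) :
    schattenNorm ∞ A ≤ C := by
  rw [schattenNorm, PiLp.norm_eq_ciSup]
  refine Real.iSup_le (fun k => ?_) hC
  simpa [Real.norm_of_nonneg (LinearMap.singularValues_nonneg _ _)] using h k

/-- The weights `‖⟨u k, f j⟩‖ * ‖⟨v k, g j⟩‖` form a doubly substochastic matrix: sums over `k`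
permit Jensen, and sums over `j` then discard the weights. -/
theorem sum_rpow_norm_inner_le_schattenNorm_rpow {m ι : Type*} [Fintype m] [DecidableEq m]
    [Fintype ι] {p : ℝ≥0∞} (hp : 1 ≤ p.toReal) (A : Matrix m m ℂ)
    {f g : ι → EuclideanSpace ℂ m} (hf : Orthonormal ℂ f) (hg : Orthonormal ℂ g) :
    ∑ j, ‖inner ℂ (f j) (Matrix.toEuclideanLin A (g j))‖ ^ p.toReal ≤
      schattenNorm p A ^ p.toReal := by
  obtain ⟨u, v, huv⟩ := A.exists_singularValueDecomposition
  rw [schattenNorm_rpow (by linarith)]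
  set σ : Fin (Fintype.card m) → ℝ := fun k => (Matrix.toEuclideanLin A).singularValues (k : ℕ)
  have hσ : ∀ k, 0 ≤ σ k := fun k => LinearMap.singularValues_nonneg _ _
  have hpos : ∀ j k, 0 ≤ ‖inner ℂ (u k) (f j)‖ * ‖inner ℂ (v k) (g j)‖ := fun j k => by positivity
  calc ∑ j, ‖inner ℂ (f j) (Matrix.toEuclideanLin A (g j))‖ ^ p.toReal
      ≤ ∑ j, ∑ k, (‖inner ℂ (u k) (f j)‖ * ‖inner ℂ (v k) (g j)‖) * σ k ^ p.toReal := by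
        refine Finset.sum_le_sum fun j _ => ?_
        refine (Real.rpow_le_rpow (norm_nonneg _)
          (LinearMap.norm_inner_le_sum_singularValues hσ huv _ _) (by linarith)).trans ?_
        exact Real.rpow_sum_mul_le_sum_mul_rpow (hpos j)
          (u.orthonormal.sum_norm_inner_mul_norm_inner_le v.orthonormal (hf.1 j) (hg.1 j)) hσ hp
    _ = ∑ k, (∑ j, ‖inner ℂ (f j) (u k)‖ * ‖inner ℂ (g j) (v k)‖) * σ k ^ p.toReal := by
        rw [Finset.sum_comm]
        simp only [Finset.sum_mul, norm_inner_symm (u _), norm_inner_symm (v _)]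
    _ ≤ ∑ k, σ k ^ p.toReal := Finset.sum_le_sum fun k _ =>
        mul_le_of_le_one_left (Real.rpow_nonneg (hσ k) _)
          (hf.sum_norm_inner_mul_norm_inner_le hg (u.orthonormal.1 k) (v.orthonormal.1 k))

theorem norm_inner_le_schattenNorm_top {m : Type*} [Fintype m] [DecidableEq m] (A : Matrix m m ℂ)
    {x y : EuclideanSpace ℂ m} (hx : ‖x‖ = 1) (hy : ‖y‖ = 1) :
    ‖inner ℂ x (Matrix.toEuclideanLin A y)‖ ≤ schattenNorm ∞ A := by
  obtain ⟨u, v, huv⟩ := A.exists_singularValueDecomposition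
  refine (LinearMap.norm_inner_le_sum_singularValues
    (fun k => LinearMap.singularValues_nonneg _ _) huv _ _).trans ?_
  refine (Finset.sum_le_sum fun k _ => mul_le_mul_of_nonneg_left
    (singularValues_le_schattenNorm_top A k) (by positivity)).trans ?_
  rw [← Finset.sum_mul]
  exact mul_le_of_le_one_left (schattenNorm_nonneg le_top A)
    (u.orthonormal.sum_norm_inner_mul_norm_inner_le v.orthonormal hx hy)

/-! ### Partial traces through product vectors -/

/-- The vector `u ⊗ e` of `(ℂ^d)^{⊗n}`, where `u` is a vector in the `i`-th factor and `e` a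
standard basis vector of the product of the other factors. -/
noncomputable def tensorSingle {n d : ℕ} (i : Fin n) (u : EuclideanSpace ℂ (Fin d))
    (e : {j // j ≠ i} → Fin d) : EuclideanSpace ℂ (Fin n → Fin d) :=
  WithLp.toLp 2 fun x => if (fun j : {j // j ≠ i} => x j) = e then u (x i) else 0

theorem sum_eq_sum_funSplitAt {n d : ℕ} (i : Fin n) {R : Type*} [AddCommMonoid R]
    (F : (Fin n → Fin d) → R) :
    ∑ x, F x = ∑ e : {j // j ≠ i} → Fin d, ∑ a, F ((Equiv.funSplitAt i (Fin d)).symm (a, e)) := by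
  rw [← (Equiv.funSplitAt i (Fin d)).symm.sum_comp, Fintype.sum_prod_type_right]

theorem tensorSingle_funSplitAt {n d : ℕ} (i : Fin n) (u : EuclideanSpace ℂ (Fin d))
    (e e' : {j // j ≠ i} → Fin d) (a : Fin d) :
    tensorSingle i u e ((Equiv.funSplitAt i (Fin d)).symm (a, e')) =
      if e' = e then u a else 0 := by
  have h : (fun j : {j // j ≠ i} => (Equiv.funSplitAt i (Fin d)).symm (a, e') j) = e' := by
    ext j
    simp [j.2]
  simp only [tensorSingle, h]
  simp

theorem inner_tensorSingle {n d : ℕ} (i : Fin n) (u : EuclideanSpace ℂ (Fin d))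
    (e : {j // j ≠ i} → Fin d) (w : EuclideanSpace ℂ (Fin n → Fin d)) :
    inner ℂ (tensorSingle i u e) w =
      ∑ a, w ((Equiv.funSplitAt i (Fin d)).symm (a, e)) * star (u a) := by
  rw [PiLp.inner_apply, sum_eq_sum_funSplitAt i, Finset.sum_eq_single e]
  · simp [tensorSingle_funSplitAt]
  · intro e' _ he
    simp [tensorSingle_funSplitAt, he]
  · simp

theorem Orthonormal.tensorSingle {n d : ℕ} (i : Fin n) {ι : Type*}
    {u : ι → EuclideanSpace ℂ (Fin d)} (hu : Orthonormal ℂ u) :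
    Orthonormal ℂ fun q : ι × ({j // j ≠ i} → Fin d) => tensorSingle i (u q.1) q.2 := by
  classical
  rw [orthonormal_iff_ite] at hu ⊢
  rintro ⟨k, e⟩ ⟨l, e'⟩
  rw [inner_tensorSingle]
  simp only [tensorSingle_funSplitAt, Prod.mk.injEq]
  by_cases he : e = e'
  · simpa [he, PiLp.inner_apply] using hu k l
  · simp [he]

theorem partialTrace_apply {n d : ℕ} (i : Fin n) (M : Matrix (Fin n → Fin d) (Fin n → Fin d) ℂ)
    (a b : Fin d) :
    partialTrace i M a b = ∑ e : {j // j ≠ i} → Fin d,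
      M ((Equiv.funSplitAt i (Fin d)).symm (a, e)) ((Equiv.funSplitAt i (Fin d)).symm (b, e)) := by
  have hup : ∀ c e, Function.update ((Equiv.funSplitAt i (Fin d)).symm (c, e)) i b =
      (Equiv.funSplitAt i (Fin d)).symm (b, e) := by
    intro c e
    ext j
    by_cases hj : j = i
    · subst hj
      simp
    · simp [hj]
  rw [partialTrace, Matrix.of_apply, Finset.sum_filter, sum_eq_sum_funSplitAt i]
  refine Finset.sum_congr rfl fun e _ => ?_
  simp only [hup]
  simp

theorem inner_partialTrace {n d : ℕ} (i : Fin n) (M : Matrix (Fin n → Fin d) (Fin n → Fin d) ℂ)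
    (u v : EuclideanSpace ℂ (Fin d)) :
    inner ℂ u (Matrix.toEuclideanLin (partialTrace i M) v) =
      ∑ e, inner ℂ (tensorSingle i u e) (Matrix.toEuclideanLin M (tensorSingle i v e)) := by
  have hM : ∀ (e : {j // j ≠ i} → Fin d) (x : Fin n → Fin d),
      Matrix.toEuclideanLin M (tensorSingle i v e) x =
        ∑ b, M x ((Equiv.funSplitAt i (Fin d)).symm (b, e)) * v b := by
    intro e x
    rw [Matrix.toLpLin_apply]
    change ∑ y, M x y * tensorSingle i v e y = _
    rw [sum_eq_sum_funSplitAt i, Finset.sum_eq_single e]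
    · simp only [tensorSingle_funSplitAt, if_true]
    · intro e' _ he
      simp [tensorSingle_funSplitAt, he]
    · simp
  have hT : ∀ a, Matrix.toEuclideanLin (partialTrace i M) v a =
      ∑ b, partialTrace i M a b * v b := fun a => rfl
  simp only [inner_tensorSingle, hM]
  rw [PiLp.inner_apply, Finset.sum_comm]
  refine Finset.sum_congr rfl fun a _ => ?_
  simp only [hT, partialTrace_apply, RCLike.inner_apply, Finset.sum_mul]
  rw [Finset.sum_comm]
  rfl

theorem singularValues_partialTrace_le {n d : ℕ} (i : Fin n)
    (M : Matrix (Fin n → Fin d) (Fin n → Fin d) ℂ) {s : ℝ} {u v : EuclideanSpace ℂ (Fin d)}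
    (hu : ‖u‖ = 1) (h : Matrix.toEuclideanLin (partialTrace i M) v = (s : ℂ) • u) :
    s ≤ ∑ e, ‖inner ℂ (tensorSingle i u e) (Matrix.toEuclideanLin M (tensorSingle i v e))‖ := by
  refine le_trans ?_ (norm_sum_le _ _)
  rw [← inner_partialTrace, h, inner_smul_right, inner_self_eq_norm_sq_to_K, hu]
  simpa using le_abs_self s

theorem card_funSplitAt {n d : ℕ} (i : Fin n) :
    Fintype.card ({j // j ≠ i} → Fin d) = d ^ (n - 1) := by
  simp

/-- The `i`-th partial trace is bounded by `d ^ ((n - 1) * (1 - 1 / p))` in the Schatten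
`p`-norms. -/
theorem schattenNorm_partialTrace_le {n d : ℕ} {p : ℝ≥0∞} (hp : 1 ≤ p) (i : Fin n)
    (M : Matrix (Fin n → Fin d) (Fin n → Fin d) ℂ) :
    schattenNorm p (partialTrace i M) ≤
      (d : ℝ) ^ (((n : ℝ) - 1) * (1 - (p⁻¹).toReal)) * schattenNorm p M := by
  -- Truncated subtraction is harmless: `i : Fin n` forces `1 ≤ n`.
  have hn : ((n - 1 : ℕ) : ℝ) = (n : ℝ) - 1 := by
    rw [Nat.cast_sub (by have := i.2; omega)]
    simp
  rw [← hn, Real.rpow_mul (Nat.cast_nonneg d), Real.rpow_natCast, ← Nat.cast_pow,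
    ← card_funSplitAt i]
  obtain ⟨u, v, huv⟩ := (partialTrace i M).exists_singularValueDecomposition
  have hU := u.orthonormal.tensorSingle i
  have hV := v.orthonormal.tensorSingle i
  have hs := fun k => singularValues_partialTrace_le i M (u.orthonormal.1 k) (huv k)
  rcases eq_or_ne p ∞ with rfl | htop
  · simp only [ENNReal.inv_top, ENNReal.toReal_zero, sub_zero, Real.rpow_one]
    refine schattenNorm_top_le (mul_nonneg (Nat.cast_nonneg _) (schattenNorm_nonneg hp M))
      fun k => (hs k).trans ?_
    refine (Finset.sum_le_card_nsmul _ _ _ fun e _ =>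
      norm_inner_le_schattenNorm_top M (hU.1 (k, e)) (hV.1 (k, e))).trans_eq ?_
    rw [nsmul_eq_mul, Finset.card_univ]
  have hp1 : 1 ≤ p.toReal := by
    simpa using ENNReal.toReal_mono htop hp
  have hp0 : 0 < p.toReal := by linarith
  set D : ℝ := (Fintype.card ({j // j ≠ i} → Fin d) : ℝ)
  have hD : 0 ≤ D := Nat.cast_nonneg _
  rw [← Real.rpow_le_rpow_iff (schattenNorm_nonneg hp _)
    (mul_nonneg (Real.rpow_nonneg hD _) (schattenNorm_nonneg hp _)) hp0,
    Real.mul_rpow (Real.rpow_nonneg hD _) (schattenNorm_nonneg hp _), ← Real.rpow_mul hD,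
    ENNReal.toReal_inv, sub_mul, one_mul, inv_mul_cancel₀ hp0.ne', schattenNorm_rpow hp0]
  calc _ ≤ ∑ k, D ^ (p.toReal - 1) * ∑ e, ‖inner ℂ (tensorSingle i (u k) e)
            (Matrix.toEuclideanLin M (tensorSingle i (v k) e))‖ ^ p.toReal := by
        refine Finset.sum_le_sum fun k _ => ?_
        refine (Real.rpow_le_rpow (LinearMap.singularValues_nonneg _ _) (hs k) hp0.le).trans ?_
        exact Real.rpow_sum_le_const_mul_sum_rpow_of_nonneg Finset.univ hp1
          fun e _ => norm_nonneg _
    _ ≤ _ := by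
        rw [← Finset.mul_sum, ← Fintype.sum_prod_type' fun k e => ‖inner ℂ (tensorSingle i (u k) e)
            (Matrix.toEuclideanLin M (tensorSingle i (v k) e))‖ ^ p.toReal]
        exact mul_le_mul_of_nonneg_left
          (sum_rpow_norm_inner_le_schattenNorm_rpow hp1 M hU hV) (Real.rpow_nonneg hD _)

/-! ### The equality case and the conclusion -/

theorem schattenNorm_smul_one {m : Type*} [Fintype m] [DecidableEq m] [Nonempty m] {p : ℝ≥0∞}
    (hp : 1 ≤ p) {c : ℝ} (hc : 0 ≤ c) :
    schattenNorm p ((c : ℂ) • (1 : Matrix m m ℂ)) =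
      (Fintype.card m : ℝ) ^ (p⁻¹).toReal * c := by
  have : Fact (1 ≤ p) := ⟨hp⟩
  have : Nonempty (Fin (Fintype.card m)) := ⟨⟨0, Fintype.card_pos⟩⟩
  obtain ⟨u, v, huv⟩ := ((c : ℂ) • (1 : Matrix m m ℂ)).exists_singularValueDecomposition
  have hσ : (fun k : Fin (Fintype.card m) =>
      (Matrix.toEuclideanLin ((c : ℂ) • (1 : Matrix m m ℂ))).singularValues (k : ℕ)) =
      Function.const _ c := by
    funext k
    have hv : Matrix.toEuclideanLin ((c : ℂ) • (1 : Matrix m m ℂ)) (v k) = (c : ℂ) • v k := by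
      rw [Matrix.toLpLin_apply, Matrix.smul_mulVec, Matrix.one_mulVec]
      rfl
    -- Norms alone identify the singular value, whatever `u k` is.
    have h := congrArg norm (huv k)
    rw [hv, norm_smul, norm_smul, u.orthonormal.1, v.orthonormal.1, mul_one, mul_one, Complex.norm_real, Complex.norm_real,
      Real.norm_of_nonneg hc, Real.norm_of_nonneg (LinearMap.singularValues_nonneg _ _)] at h
    exact h.symm
  rw [schattenNorm, hσ, PiLp.norm_toLp_const']
  simp [Real.norm_of_nonneg hc]

theorem schattenNorm_of_isEmpty {m : Type*} [Fintype m] [DecidableEq m] [IsEmpty m] {p : ℝ≥0∞}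
    (hp : 1 ≤ p) (A : Matrix m m ℂ) : schattenNorm p A = 0 := by
  have : Fact (1 ≤ p) := ⟨hp⟩
  have : IsEmpty (Fin (Fintype.card m)) := by
    rw [Fintype.card_eq_zero]
    infer_instance
  rw [schattenNorm, norm_eq_zero]
  exact Subsingleton.elim _ _

theorem tensorMatrix_one {n d : ℕ} :
    tensorMatrix (fun _ : Fin n => (1 : Matrix (Fin d) (Fin d) ℂ)) = 1 := by
  ext x y
  simp only [tensorMatrix, Matrix.of_apply, Matrix.one_apply, Finset.prod_ite_zero,
    Finset.prod_const_one, funext_iff, Finset.mem_univ, true_implies]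

theorem partialTrace_one {n d : ℕ} (i : Fin n) :
    partialTrace i (1 : Matrix (Fin n → Fin d) (Fin n → Fin d) ℂ) =
      (((d : ℝ) ^ (n - 1) : ℝ) : ℂ) • (1 : Matrix (Fin d) (Fin d) ℂ) := by
  ext a b
  rw [partialTrace_apply]
  simp only [Matrix.one_apply, EmbeddingLike.apply_eq_iff_eq, Prod.mk.injEq, and_true,
    Finset.sum_const, Finset.card_univ, card_funSplitAt, Matrix.smul_apply, nsmul_eq_mul,
    smul_eq_mul]
  push_cast
  rfl

theorem mainTheorem11 (n d : ℕ) (p : ℝ≥0∞) (hp : 1 ≤ p) :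
    (∀ M : Matrix (Fin n → Fin d) (Fin n → Fin d) ℂ,
      ∑ i : Fin n, schattenNorm p (partialTrace i M) ≤
        n * (d : ℝ) ^ (((n : ℝ) - 1) * (1 - (p⁻¹).toReal)) * schattenNorm p M) ∧
    ∑ i : Fin n, schattenNorm p
        (partialTrace i (tensorMatrix fun _ : Fin n => (1 : Matrix (Fin d) (Fin d) ℂ))) =
      n * (d : ℝ) ^ (((n : ℝ) - 1) * (1 - (p⁻¹).toReal)) *
        schattenNorm p (tensorMatrix fun _ : Fin n => (1 : Matrix (Fin d) (Fin d) ℂ)) := by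
  refine ⟨fun M => ?_, ?_⟩
  · refine (Finset.sum_le_sum fun i _ => schattenNorm_partialTrace_le hp i M).trans_eq ?_
    simp [mul_assoc]
  rw [tensorMatrix_one, mul_assoc]
  refine (Finset.sum_congr rfl fun i _ => ?_ : _ = ∑ _i : Fin n,
    (d : ℝ) ^ (((n : ℝ) - 1) * (1 - (p⁻¹).toReal)) *
      schattenNorm p (1 : Matrix (Fin n → Fin d) (Fin n → Fin d) ℂ)).trans (by simp)
  -- Adding real exponents needs a positive base; for `d = 0` all matrices are empty.
  rcases Nat.eq_zero_or_pos d with rfl | hd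
  · have : IsEmpty (Fin n → Fin 0) := ⟨fun x => (x i).elim0⟩
    rw [schattenNorm_of_isEmpty hp, schattenNorm_of_isEmpty hp, mul_zero]
  have : Nonempty (Fin d) := ⟨⟨0, hd⟩⟩
  have hd' : (0 : ℝ) < d := Nat.cast_pos.mpr hd
  have hn : ((n - 1 : ℕ) : ℝ) = (n : ℝ) - 1 := by
    rw [Nat.cast_sub (by have := i.2; omega)]
    simp
  have hone := schattenNorm_smul_one (m := Fin n → Fin d) hp zero_le_one
  rw [Complex.ofReal_one, one_smul] at hone
  rw [partialTrace_one, schattenNorm_smul_one hp (by positivity), hone]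
  simp only [Fintype.card_fin, Fintype.card_pi, Finset.prod_const, Finset.card_univ, Nat.cast_pow,
    mul_one]
  -- Both exponents of `d` equal `n - 1 + 1 / p`.
  rw [← Real.rpow_natCast, ← Real.rpow_natCast, hn, ← Real.rpow_mul hd'.le, ← Real.rpow_add hd',
    ← Real.rpow_add hd']
  congr 1
  ring
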